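/- Let $\mathbb{B}^k=\{z\in\mathbb{C}^k : \|z\|<1\}$ be the open unit ball and let $\mathrm{Aut}(\mathbb{B}^k)$ be its group of holomorphic automorphisms (holomorphic bijections of $\mathbb{B}^k$ with holomorphic inverse). For a map $f:\mathbb{B}^n\to\mathbb{B}^N$ define its Hermitian invariant group by $$\Gamma_f=\{\gamma\in\mathrm{Aut}(\mathbb{B}^n) : \text{there is } \psi\in\mathrm{Aut}(\mathbb{B}^N) \text{ with } f\circ\gamma=\psi\circ f\}.$$ Regard the symmetric group $S_n$ as the subgroup of $\mathrm{Aut}(\mathbb{B}^n)$ consisting of all permutations of the coordinates $z_1,\dots,z_n$. Then for each $n$ there exist $N$ and a proper map $f:\mathbb{B}^n\to\mathbb{B}^N$ with polynomial components such that $\Gamma_f=S_n$ (equality of subgroups of $\mathrm{Aut}(\mathbb{B}^n)$). Moreover, for each $n\ge 2$ there exist $N$ and such a map $f$ of degree exactly $3$, where the degree of a polynomial map is the largest total degree of its components. -/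

import Mathlib

/-- The open unit ball `𝔹ⁿ` of `ℂⁿ` (Euclidean norm), as a subtype. -/
abbrev UnitBall (n : ℕ) : Type :=
  Metric.ball (0 : EuclideanSpace ℂ (Fin n)) 1

/-- A map between unit balls is holomorphic if it is the restriction of a function that is
complex differentiable on the open unit ball of the source. -/
def IsHolomorphicBallMap {n N : ℕ} (g : UnitBall n → UnitBall N) : Prop :=
  ∃ F : EuclideanSpace ℂ (Fin n) → EuclideanSpace ℂ (Fin N),
    DifferentiableOn ℂ F (Metric.ball 0 1) ∧ ∀ z : UnitBall n, F z = g z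

theorem IsHolomorphicBallMap.comp {n m k : ℕ} {g : UnitBall m → UnitBall k}
    {h : UnitBall n → UnitBall m} (hg : IsHolomorphicBallMap g) (hh : IsHolomorphicBallMap h) :
    IsHolomorphicBallMap (g ∘ h) := by
  obtain ⟨G, hG, hGg⟩ := hg
  obtain ⟨H, hH, hHh⟩ := hh
  refine ⟨G ∘ H, hG.comp hH ?_, fun z => ?_⟩
  · intro z hz
    rw [hHh ⟨z, hz⟩]
    exact (h ⟨z, hz⟩).2
  · simp [hHh, hGg]

/-- The holomorphic automorphism group `Aut(𝔹ⁿ)`: bijections of the ball that are holomorphic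
together with their inverses, under composition. -/
def ballAut (n : ℕ) : Subgroup (Equiv.Perm (UnitBall n)) where
  carrier := {e | IsHolomorphicBallMap (fun z => e z) ∧
    IsHolomorphicBallMap (fun z => e.symm z)}
  mul_mem' {_ _} ha hb := ⟨ha.1.comp hb.1, hb.2.comp ha.2⟩
  one_mem' := ⟨⟨id, differentiableOn_id, fun _ => rfl⟩, ⟨id, differentiableOn_id, fun _ => rfl⟩⟩
  inv_mem' {_} ha := ⟨ha.2, ha.1⟩

/-- The Hermitian invariant group `Γ_f ≤ Aut(𝔹ⁿ)` of a map `f : 𝔹ⁿ → 𝔹ᴺ`: all source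
automorphisms `γ` for which some target automorphism `ψ` satisfies `f ∘ γ = ψ ∘ f`. -/
def hermitianInvariantGroup {n N : ℕ} (f : UnitBall n → UnitBall N) :
    Subgroup (ballAut n) where
  carrier := {γ | ∃ ψ : ballAut N, ∀ z : UnitBall n, f (γ.1 z) = ψ.1 (f z)}
  mul_mem' {a b} := by
    rintro ⟨ψ, hψ⟩ ⟨χ, hχ⟩
    exact ⟨ψ * χ, fun z => by simp [hψ, hχ]⟩
  one_mem' := ⟨1, fun _ => rfl⟩
  inv_mem' {a} := by
    rintro ⟨ψ, hψ⟩
    refine ⟨ψ⁻¹, fun z => ?_⟩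
    have h := hψ (a.1.symm z)
    rw [Equiv.apply_symm_apply] at h
    exact ((Equiv.symm_apply_eq ψ.1).2 h).symm

/-- The permutation `σ` acting on the ball by `(σ z)ᵢ = z_{σ⁻¹ i}`. -/
noncomputable def coordPerm {n : ℕ} (σ : Equiv.Perm (Fin n)) : Equiv.Perm (UnitBall n) where
  toFun z := ⟨LinearIsometryEquiv.piLpCongrLeft 2 ℂ ℂ σ z.1, by
    have h := z.2
    rw [mem_ball_zero_iff] at h ⊢
    rwa [LinearIsometryEquiv.norm_map]⟩
  invFun z := ⟨LinearIsometryEquiv.piLpCongrLeft 2 ℂ ℂ σ.symm z.1, by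
    have h := z.2
    rw [mem_ball_zero_iff] at h ⊢
    rwa [LinearIsometryEquiv.norm_map]⟩
  left_inv z := by
    ext i
    simp [LinearIsometryEquiv.piLpCongrLeft_apply]
  right_inv z := by
    ext i
    simp [LinearIsometryEquiv.piLpCongrLeft_apply]

theorem coordPerm_apply {n : ℕ} (σ : Equiv.Perm (Fin n)) (z : UnitBall n) (i : Fin n) :
    (coordPerm σ z).1 i = z.1 (σ.symm i) := rfl

theorem coordPerm_mem_ballAut {n : ℕ} (σ : Equiv.Perm (Fin n)) : coordPerm σ ∈ ballAut n :=
  ⟨⟨LinearIsometryEquiv.piLpCongrLeft 2 ℂ ℂ σ,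
      (LinearIsometryEquiv.piLpCongrLeft 2 ℂ ℂ σ).differentiable.differentiableOn, fun _ => rfl⟩,
    ⟨LinearIsometryEquiv.piLpCongrLeft 2 ℂ ℂ σ.symm,
      (LinearIsometryEquiv.piLpCongrLeft 2 ℂ ℂ σ.symm).differentiable.differentiableOn,
      fun _ => rfl⟩⟩

/-- The representation of the symmetric group `S_n` in `Aut(𝔹ⁿ)` by coordinate permutations. -/
noncomputable def coordPermHom (n : ℕ) : Equiv.Perm (Fin n) →* ballAut n where
  toFun σ := ⟨coordPerm σ, coordPerm_mem_ballAut σ⟩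
  map_one' := rfl
  map_mul' _ _ := rfl

/-- The symmetric group `S_n`, as the subgroup of `Aut(𝔹ⁿ)` of all coordinate permutations. -/
noncomputable def symmetricSubgroup (n : ℕ) : Subgroup (ballAut n) :=
  (coordPermHom n).range

/-- The map `f : 𝔹ⁿ → 𝔹ᴺ` is given in coordinates by the polynomials `p`. -/
def IsGivenBy {n N : ℕ} (f : UnitBall n → UnitBall N)
    (p : Fin N → MvPolynomial (Fin n) ℂ) : Prop :=
  ∀ (z : UnitBall n) (i : Fin N), (f z).1 i = MvPolynomial.eval (fun j => z.1 j) (p i)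

/-- The degree of a polynomial map: the largest total degree of a component. -/
def polyMapDegree {n N : ℕ} (p : Fin N → MvPolynomial (Fin n) ℂ) : ℕ :=
  Finset.univ.sup fun i => (p i).totalDegree

/-! One cubic map serves both claims. Start from the sphere map `(3/5 z, 4/5 z ⊗ z)`. For each `j`,
rotate the pair `(3/5 z_j, 4/5 z_j²)` into `c(z_j) = 9/25 z_j + 16/25 z_j²` and `12/25 (z_j² -
z_j)`, then tensor each `c(z_j)` with `z`. The construction is symmetric in the coordinates, and `1
- ⟪f w, f z⟫ = (1 - ⟪w, z⟫) Q(w, z)` with `Q = 1 + 16/25 ⟪w, z⟫ + ∑ c(z_j) conj c(w_j)`. On the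
diagonal `Q ≥ 1`, which gives properness.

If `f ∘ γ = ψ ∘ f`, then `Q` is invariant under `γ` up to explicit Möbius multipliers
(`cubicQuotient_ballAut`). Suppose `b = γ⁻¹(0) ≠ 0`. Restricting to the complex line through `b`
gives a polynomial identity that confines the roots of `t ↦ Q(γ 0, t γ 0) = 1 + ut + vt²` to the
single point `1/‖b‖²`, so `Re u ≤ 0`. The weight 16/25 of the quadratic part exceeds 9/25, which
makes `Re u > 0`, a contradiction (`eq_zero_of_intertwines`).

Hence `γ` is a linear isometry `U`, all multipliers are 1, and `U` preserves `∑ c(z_j) conj c(w_j)`.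
The part of this form odd in `w` and even in `z` is a multiple of `⟪w, z²⟫`, so `U` commutes with
coordinatewise squaring. It therefore sends each basis vector to an idempotent unit vector, again a
basis vector, and `U` is a permutation. -/

/-! ### Möbius involutions of the ball -/

/-- The scaling factor `√(1 - ‖a‖²)` of the ball involution at `a`, as a complex number. -/
noncomputable def ballScale {n : ℕ} (a : EuclideanSpace ℂ (Fin n)) : ℂ :=
  (Real.sqrt (1 - ‖a‖ ^ 2) : ℝ)

theorem ballScale_sq {n : ℕ} {a : EuclideanSpace ℂ (Fin n)} (ha : ‖a‖ < 1) :
    ballScale a ^ 2 = 1 - (‖a‖ : ℂ) ^ 2 := by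
  have h : (0 : ℝ) ≤ 1 - ‖a‖ ^ 2 := by nlinarith [norm_nonneg a]
  rw [ballScale]
  exact_mod_cast congrArg (fun t : ℝ => (t : ℂ)) (Real.sq_sqrt h)

theorem inner_self_eq_ofReal_norm_sq {n : ℕ} (x : EuclideanSpace ℂ (Fin n)) :
    inner ℂ x x = (‖x‖ : ℂ) ^ 2 :=
  inner_self_eq_norm_sq_to_K x

theorem one_add_ballScale_ne_zero {n : ℕ} (a : EuclideanSpace ℂ (Fin n)) :
    1 + ballScale a ≠ 0 := by
  rw [ballScale]
  have h := Real.sqrt_nonneg (1 - ‖a‖ ^ 2)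
  exact_mod_cast (by positivity : 1 + Real.sqrt (1 - ‖a‖ ^ 2) ≠ 0)

theorem ballScale_sq_ne_zero {n : ℕ} {a : EuclideanSpace ℂ (Fin n)} (ha : ‖a‖ < 1) :
    ballScale a ^ 2 ≠ 0 := by
  rw [ballScale_sq ha]
  have : 1 - ‖a‖ ^ 2 ≠ 0 := by nlinarith [norm_nonneg a]
  exact_mod_cast this

theorem one_sub_inner_ne_zero {n : ℕ} {a z : EuclideanSpace ℂ (Fin n)} (ha : ‖a‖ < 1)
    (hz : ‖z‖ < 1) : 1 - inner ℂ a z ≠ 0 := by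
  intro h
  have h1 : ‖(1 : ℂ)‖ ≤ ‖a‖ * ‖z‖ := by
    rw [sub_eq_zero.1 h]
    exact norm_inner_le_norm a z
  rw [norm_one] at h1
  nlinarith [norm_nonneg a, norm_nonneg z]

/-- The numerator of the ball involution, a linear map. -/
noncomputable def mobiusLin {n : ℕ} (a z : EuclideanSpace ℂ (Fin n)) :
    EuclideanSpace ℂ (Fin n) :=
  ballScale a • z + (inner ℂ a z / (1 + ballScale a)) • a

/-- The involutive automorphism of the unit ball exchanging `0` and `a`. -/
noncomputable def mobius {n : ℕ} (a z : EuclideanSpace ℂ (Fin n)) :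
    EuclideanSpace ℂ (Fin n) :=
  (1 - inner ℂ a z)⁻¹ • (a - mobiusLin a z)

theorem mobius_zero {n : ℕ} (a : EuclideanSpace ℂ (Fin n)) : mobius a 0 = a := by
  simp [mobius, mobiusLin]

theorem inner_mobiusLin_left {n : ℕ} {a : EuclideanSpace ℂ (Fin n)} (ha : ‖a‖ < 1)
    (z : EuclideanSpace ℂ (Fin n)) : inner ℂ a (mobiusLin a z) = inner ℂ a z := by
  have h1 := one_add_ballScale_ne_zero a
  have h2 := ballScale_sq ha
  rw [mobiusLin, inner_add_right, inner_smul_right, inner_smul_right, inner_self_eq_ofReal_norm_sq]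
  have h3 : ((‖a‖ : ℝ) : ℂ) ^ 2 = 1 - ballScale a ^ 2 := by rw [h2]; ring
  simp only [h3]
  field_simp
  ring

theorem star_ballScale {n : ℕ} (a : EuclideanSpace ℂ (Fin n)) :
    (starRingEnd ℂ) (ballScale a) = ballScale a := by
  simp [ballScale]

theorem inner_mobiusLin_mobiusLin {n : ℕ} {a : EuclideanSpace ℂ (Fin n)} (ha : ‖a‖ < 1)
    (w z : EuclideanSpace ℂ (Fin n)) :
    inner ℂ (mobiusLin a w) (mobiusLin a z) =
      ballScale a ^ 2 * inner ℂ w z + inner ℂ w a * inner ℂ a z := by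
  have h1 := one_add_ballScale_ne_zero a
  conv_lhs => enter [2]; rw [mobiusLin]
  rw [inner_add_left, inner_smul_left, inner_smul_left, inner_mobiusLin_left ha]
  rw [mobiusLin, inner_add_right, inner_smul_right, inner_smul_right]
  simp only [map_div₀, map_add, map_one, star_ballScale, inner_conj_symm]
  field_simp
  ring

/-- The ball involution transforms the defining function `1 - ⟪w, z⟫` by a multiplier. -/
theorem one_sub_inner_mobius {n : ℕ} {a w z : EuclideanSpace ℂ (Fin n)} (ha : ‖a‖ < 1)
    (hw : ‖w‖ < 1) (hz : ‖z‖ < 1) :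
    (1 - inner ℂ (mobius a w) (mobius a z)) * ((1 - inner ℂ w a) * (1 - inner ℂ a z)) =
      ballScale a ^ 2 * (1 - inner ℂ w z) := by
  have h1 := one_sub_inner_ne_zero ha hz
  have h2 : 1 - inner ℂ w a ≠ 0 := one_sub_inner_ne_zero hw ha
  have h3 : inner ℂ (a - mobiusLin a w) (a - mobiusLin a z) =
      1 - ballScale a ^ 2 - inner ℂ w a - inner ℂ a z +
        (ballScale a ^ 2 * inner ℂ w z + inner ℂ w a * inner ℂ a z) := by
    have h4 : inner ℂ (mobiusLin a w) a = inner ℂ w a := by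
      rw [← inner_conj_symm, inner_mobiusLin_left ha, inner_conj_symm]
    rw [inner_sub_left, inner_sub_right, inner_sub_right, inner_mobiusLin_mobiusLin ha,
      inner_mobiusLin_left ha, h4, inner_self_eq_ofReal_norm_sq, ballScale_sq ha]
    ring
  rw [mobius, mobius, inner_smul_left, inner_smul_right, h3]
  simp only [map_inv₀, map_sub, map_one, inner_conj_symm]
  field_simp
  ring

theorem norm_mobius_lt_one {n : ℕ} {a z : EuclideanSpace ℂ (Fin n)} (ha : ‖a‖ < 1)
    (hz : ‖z‖ < 1) : ‖mobius a z‖ < 1 := by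
  have h := one_sub_inner_mobius ha hz hz
  have h1 := one_sub_inner_ne_zero ha hz
  rw [ballScale_sq ha, inner_self_eq_ofReal_norm_sq, inner_self_eq_ofReal_norm_sq,
    ← inner_conj_symm z a] at h
  have h2 : (1 - (starRingEnd ℂ) (inner ℂ a z)) * (1 - inner ℂ a z) =
      ((‖1 - inner ℂ a z‖ ^ 2 : ℝ) : ℂ) := by
    rw [← Complex.normSq_eq_norm_sq, Complex.normSq_eq_conj_mul_self]
    simp
  rw [h2] at h
  have h3 : (1 - ‖mobius a z‖ ^ 2) * ‖1 - inner ℂ a z‖ ^ 2 =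
      (1 - ‖a‖ ^ 2) * (1 - ‖z‖ ^ 2) := by
    exact_mod_cast h
  have h4 : 0 < ‖1 - inner ℂ a z‖ ^ 2 := by positivity
  have h5 : 0 < (1 - ‖a‖ ^ 2) * (1 - ‖z‖ ^ 2) := by
    apply mul_pos <;> nlinarith [norm_nonneg a, norm_nonneg z]
  rw [← h3] at h5
  have h6 := (pos_iff_pos_of_mul_pos h5).2 h4
  nlinarith [norm_nonneg (mobius a z)]

theorem mobiusLin_sub {n : ℕ} (a x y : EuclideanSpace ℂ (Fin n)) :
    mobiusLin a (x - y) = mobiusLin a x - mobiusLin a y := by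
  simp only [mobiusLin, inner_sub_right, smul_sub, sub_div, sub_smul]
  abel

theorem mobiusLin_smul {n : ℕ} (a x : EuclideanSpace ℂ (Fin n)) (t : ℂ) :
    mobiusLin a (t • x) = t • mobiusLin a x := by
  simp only [mobiusLin, inner_smul_right, smul_add, smul_smul, mul_div_assoc, mul_comm]

/-- With `s = ballScale a`, the coefficient is `s + (1 - s²)/(1 + s) = 1`. Thus `mobiusLin a` is the
identity along `a` and multiplication by `s` on its orthogonal complement, written without dividing
by `‖a‖²`. -/
theorem mobiusLin_self {n : ℕ} {a : EuclideanSpace ℂ (Fin n)} (ha : ‖a‖ < 1) :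
    mobiusLin a a = a := by
  have h1 := one_add_ballScale_ne_zero a
  have h3 : ((‖a‖ : ℝ) : ℂ) ^ 2 = 1 - ballScale a ^ 2 := by rw [ballScale_sq ha]; ring
  rw [mobiusLin, inner_self_eq_ofReal_norm_sq, ← add_smul]
  simp only [h3]
  rw [show ballScale a + (1 - ballScale a ^ 2) / (1 + ballScale a) = 1 by field_simp; ring,
    one_smul]

theorem mobiusLin_mobiusLin {n : ℕ} {a : EuclideanSpace ℂ (Fin n)} (ha : ‖a‖ < 1)
    (z : EuclideanSpace ℂ (Fin n)) :
    mobiusLin a (mobiusLin a z) = ballScale a ^ 2 • z + inner ℂ a z • a := by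
  have h1 := one_add_ballScale_ne_zero a
  conv_lhs => rw [mobiusLin, inner_mobiusLin_left ha, mobiusLin]
  rw [smul_add, smul_smul, smul_smul, add_assoc, ← add_smul, ← sq]
  congr 2
  field_simp
  ring

theorem mobius_mobius {n : ℕ} {a z : EuclideanSpace ℂ (Fin n)} (ha : ‖a‖ < 1)
    (hz : ‖z‖ < 1) : mobius a (mobius a z) = z := by
  have h1 := one_sub_inner_ne_zero ha hz
  have h2 := ballScale_sq_ne_zero ha
  -- Since `0` is sent to `a`, taking `w = 0` evaluates the denominator of the second application.
  have h0 := one_sub_inner_mobius ha (w := 0) (by simp) hz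
  rw [mobius_zero] at h0
  simp only [inner_zero_left, sub_zero, one_mul, mul_one] at h0
  have h3 : (1 - inner ℂ a (mobius a z))⁻¹ = (ballScale a ^ 2)⁻¹ * (1 - inner ℂ a z) := by
    rw [← h0, mul_inv, mul_assoc, inv_mul_cancel₀ h1, mul_one]
  have h4 : mobiusLin a (mobius a z) = (1 - inner ℂ a z)⁻¹ •
      (a - (ballScale a ^ 2 • z + inner ℂ a z • a)) := by
    rw [mobius, mobiusLin_smul, mobiusLin_sub, mobiusLin_self ha, mobiusLin_mobiusLin ha]
  have h5 : a - mobiusLin a (mobius a z) =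
      ((1 - inner ℂ a z)⁻¹ * ballScale a ^ 2) • z := by
    rw [h4]
    have h6 : a = (1 - inner ℂ a z)⁻¹ • ((1 - inner ℂ a z) • a) := by
      rw [smul_smul, inv_mul_cancel₀ h1, one_smul]
    nth_rewrite 1 [h6]
    rw [← smul_sub, mul_smul, sub_smul, one_smul]
    congr 1
    abel
  rw [mobius, h5, h3, smul_smul]
  rw [mul_assoc, mul_inv_cancel_left₀ h1, inv_mul_cancel₀ h2, one_smul]

theorem differentiableOn_mobius {n : ℕ} {a : EuclideanSpace ℂ (Fin n)} (ha : ‖a‖ < 1) :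
    DifferentiableOn ℂ (mobius a) (Metric.ball 0 1) := by
  have hi : Differentiable ℂ fun z => inner ℂ a z := (innerSL ℂ a).differentiable
  have hl : Differentiable ℂ (mobiusLin a) := by
    unfold mobiusLin
    have hd : Differentiable ℂ fun z => inner ℂ a z / (1 + ballScale a) := by
      simpa only [div_eq_mul_inv] using hi.mul_const (1 + ballScale a)⁻¹
    exact (differentiable_id.const_smul (ballScale a)).add (hd.smul_const _)
  intro z hz
  rw [mem_ball_zero_iff] at hz
  refine DifferentiableAt.differentiableWithinAt ?_
  have h1 : DifferentiableAt ℂ (fun z => 1 - inner ℂ a z) z :=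
    (differentiableAt_const _).sub (hi z)
  have h2 : DifferentiableAt ℂ (fun z => a - mobiusLin a z) z :=
    (differentiableAt_const _).sub (hl z)
  exact (h1.fun_inv (one_sub_inner_ne_zero ha hz)).fun_smul h2

/-- On the line through `b` the involution is a one-variable Möbius map, which makes restriction to
that line explicit. -/
theorem mobius_smul_self {n : ℕ} {b : EuclideanSpace ℂ (Fin n)} (hb : ‖b‖ < 1) (ζ : ℂ) :
    mobius b (ζ • b) = ((1 - ζ) / (1 - (‖b‖ : ℂ) ^ 2 * ζ)) • b := by
  rw [mobius, mobiusLin_smul, mobiusLin_self hb, inner_smul_right, inner_self_eq_ofReal_norm_sq]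
  nth_rewrite 2 [← one_smul ℂ b]
  rw [← sub_smul, smul_smul, div_eq_inv_mul, mul_comm ζ]

/-! ### Structure of ball automorphisms -/

/-- **Cartan's theorem** on the unit ball: an automorphism fixing the origin is the restriction of
a linear isometry. -/
theorem exists_linearIsometry_of_fixes_zero {n : ℕ}
    {F F' : EuclideanSpace ℂ (Fin n) → EuclideanSpace ℂ (Fin n)}
    (hF : DifferentiableOn ℂ F (Metric.ball 0 1)) (hF' : DifferentiableOn ℂ F' (Metric.ball 0 1))
    (hm : Set.MapsTo F (Metric.ball 0 1) (Metric.ball 0 1))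
    (hm' : Set.MapsTo F' (Metric.ball 0 1) (Metric.ball 0 1))
    (hinv : ∀ z ∈ Metric.ball (0 : EuclideanSpace ℂ (Fin n)) 1, F' (F z) = z) (h0 : F 0 = 0) :
    ∃ L : EuclideanSpace ℂ (Fin n) →ₗᵢ[ℂ] EuclideanSpace ℂ (Fin n),
      ∀ z ∈ Metric.ball (0 : EuclideanSpace ℂ (Fin n)) 1, F z = L z := by
  have h0' : F' 0 = 0 := by
    have := hinv 0 (by simp)
    rwa [h0] at this
  have hnorm : ∀ z ∈ Metric.ball (0 : EuclideanSpace ℂ (Fin n)) 1, ‖F z‖ = ‖z‖ := by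
    intro z hz
    apply le_antisymm
    · exact Complex.norm_le_norm_of_mapsTo_ball hF
        (hm.mono_right Metric.ball_subset_closedBall) h0 (mem_ball_zero_iff.1 hz)
    · have := Complex.norm_le_norm_of_mapsTo_ball hF'
        (hm'.mono_right Metric.ball_subset_closedBall) h0' (mem_ball_zero_iff.1 (hm hz))
      rwa [hinv z hz] at this
  have hlin : ∀ z ∈ Metric.ball (0 : EuclideanSpace ℂ (Fin n)) 1, F z = fderiv ℂ F 0 z := by
    intro z hz
    rcases eq_or_ne z 0 with rfl | hz0
    · simp [h0]
    have hzpos : 0 < ‖z‖ := norm_pos_iff.2 hz0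
    have hmem : ∀ ζ ∈ Metric.ball (0 : ℂ) (1 / ‖z‖),
        ζ • z ∈ Metric.ball (0 : EuclideanSpace ℂ (Fin n)) 1 := by
      intro ζ hζ
      rw [mem_ball_zero_iff] at hζ ⊢
      rw [norm_smul]
      exact (lt_div_iff₀ hzpos).1 hζ
    have hd : DifferentiableOn ℂ (fun ζ : ℂ => F (ζ • z)) (Metric.ball 0 (1 / ‖z‖)) :=
      hF.comp (differentiable_id.smul_const z).differentiableOn hmem
    have h1 : (1 : ℂ) ∈ Metric.ball (0 : ℂ) (1 / ‖z‖) := by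
      rw [mem_ball_zero_iff, norm_one]
      exact (one_lt_div hzpos).2 (mem_ball_zero_iff.1 hz)
    have hslope : dslope (fun ζ : ℂ => F (ζ • z)) 0 1 = F z := by
      rw [dslope_of_ne _ one_ne_zero, slope_def_module]
      simp [h0]
    -- Equality case of the Schwarz lemma: on the disc of radius `1 / ‖z‖` the slope at `ζ = 1` has
    -- the extremal norm `‖z‖`, so the slice is linear.
    have haff := Complex.affine_of_mapsTo_ball_of_norm_dslope_eq_div (R₂ := 1) hd
      (fun ζ hζ => by simpa [h0] using (mem_ball_zero_iff.1 (hm (hmem ζ hζ))).le) h1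
      (by rw [hslope, hnorm z hz]; simp)
    have hder1 : HasDerivAt (fun ζ : ℂ => F (ζ • z)) (F z) 0 := by
      have h2 : HasDerivAt (fun ζ : ℂ => ζ • F z) (F z) 0 := by
        simpa using (hasDerivAt_id (0 : ℂ)).smul_const (F z)
      refine h2.congr_of_eventuallyEq ?_
      filter_upwards [Metric.ball_mem_nhds (0 : ℂ) (one_div_pos.2 hzpos)] with ζ hζ
      have := haff hζ
      simp only [hslope, zero_smul, h0, sub_zero, zero_add] at this
      exact this
    have hder2 : HasDerivAt (fun ζ : ℂ => F (ζ • z)) (fderiv ℂ F 0 z) 0 := by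
      have h3 : HasDerivAt (fun ζ : ℂ => ζ • z) z 0 := by
        simpa using (hasDerivAt_id (0 : ℂ)).smul_const z
      have h4 : HasFDerivAt F (fderiv ℂ F 0) ((0 : ℂ) • z) := by
        rw [zero_smul]
        exact (hF.differentiableAt (Metric.ball_mem_nhds _ one_pos)).hasFDerivAt
      exact h4.comp_hasDerivAt (0 : ℂ) h3
    exact hder1.unique hder2
  refine ⟨⟨(fderiv ℂ F 0).toLinearMap, fun z => ?_⟩, fun z hz => hlin z hz⟩
  obtain ⟨t, ht, htz⟩ : ∃ t : ℝ, 0 < t ∧ t * ‖z‖ < 1 :=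
    ⟨1 / (‖z‖ + 1), by positivity, by
      rw [one_div, inv_mul_lt_iff₀ (by positivity)]; linarith⟩
  have hmem : (t : ℂ) • z ∈ Metric.ball (0 : EuclideanSpace ℂ (Fin n)) 1 := by
    rw [mem_ball_zero_iff, norm_smul, Complex.norm_real, Real.norm_of_nonneg ht.le]
    exact htz
  have h5 := hnorm _ hmem
  rw [hlin _ hmem, map_smul, norm_smul, norm_smul] at h5
  have h6 : ‖(t : ℂ)‖ ≠ 0 := by simpa using ht.ne'
  exact mul_left_cancel₀ h6 h5

/-- Every automorphism of the ball is an involution `mobius b` followed by a linear isometry. -/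
theorem exists_eq_linearIsometry_mobius {n : ℕ} (e : ballAut n) :
    ∃ (L : EuclideanSpace ℂ (Fin n) →ₗᵢ[ℂ] EuclideanSpace ℂ (Fin n))
      (b : EuclideanSpace ℂ (Fin n)), ‖b‖ < 1 ∧
      ∀ z : UnitBall n, (e.1 z).1 = L (mobius b z) := by
  obtain ⟨e, ⟨F, hF, hFe⟩, ⟨F', hF', hFe'⟩⟩ := e
  set o : UnitBall n := ⟨0, by simp⟩
  -- With `b` the preimage of the origin, `e ∘ mobius b` fixes the origin and Cartan's theorem
  -- applies.
  set b : UnitBall n := e.symm o with hb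
  have hb1 : ‖b.1‖ < 1 := mem_ball_zero_iff.1 b.2
  have hmm : Set.MapsTo (mobius b.1) (Metric.ball 0 1) (Metric.ball 0 1) := fun z hz =>
    mem_ball_zero_iff.2 (norm_mobius_lt_one hb1 (mem_ball_zero_iff.1 hz))
  have hm : Set.MapsTo F (Metric.ball 0 1) (Metric.ball 0 1) := fun z hz => by
    rw [hFe ⟨z, hz⟩]; exact (e ⟨z, hz⟩).2
  have hm' : Set.MapsTo F' (Metric.ball 0 1) (Metric.ball 0 1) := fun z hz => by
    rw [hFe' ⟨z, hz⟩]; exact (e.symm ⟨z, hz⟩).2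
  obtain ⟨L, hL⟩ := exists_linearIsometry_of_fixes_zero (F := F ∘ mobius b.1)
    (F' := mobius b.1 ∘ F') (hF.comp (differentiableOn_mobius hb1) hmm)
    ((differentiableOn_mobius hb1).comp hF' hm') (hm.comp hmm) (hmm.comp hm')
    (fun z hz => by
      simp only [Function.comp_apply]
      rw [hFe ⟨_, hmm hz⟩, hFe' (e ⟨_, hmm hz⟩)]
      beta_reduce
      rw [e.symm_apply_apply]
      exact mobius_mobius hb1 (mem_ball_zero_iff.1 hz))
    (by
      simp only [Function.comp_apply, mobius_zero]
      rw [hFe b, hb]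
      beta_reduce
      rw [e.apply_symm_apply])
  refine ⟨L, b.1, hb1, fun z => ?_⟩
  rw [← hL _ (hmm z.2), Function.comp_apply, mobius_mobius hb1 (mem_ball_zero_iff.1 z.2), hFe z]

theorem one_sub_inner_ballAut {n : ℕ} {e : ballAut n}
    {L : EuclideanSpace ℂ (Fin n) →ₗᵢ[ℂ] EuclideanSpace ℂ (Fin n)}
    {b : EuclideanSpace ℂ (Fin n)} (hb : ‖b‖ < 1)
    (h : ∀ z : UnitBall n, (e.1 z).1 = L (mobius b z)) (w z : UnitBall n) :
    (1 - inner ℂ (e.1 w).1 (e.1 z).1) * ((1 - inner ℂ w.1 b) * (1 - inner ℂ b z.1)) =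
      ballScale b ^ 2 * (1 - inner ℂ w.1 z.1) := by
  rw [h, h, L.inner_map_map]
  exact one_sub_inner_mobius hb (mem_ball_zero_iff.1 w.2) (mem_ball_zero_iff.1 z.2)

/-! ### The symmetric cubic map: norm identity, properness, degree -/

/-- The univariate polynomial `9/25 x + 16/25 x²`. -/
noncomputable def mixPoly (x : ℂ) : ℂ := 9 / 25 * x + 16 / 25 * x ^ 2

/-- The index set of the components of the symmetric cubic map. -/
abbrev CubicIndex (n : ℕ) : Type := (Fin n × Fin n) ⊕ (Fin n × Fin n)

/-- The components of the symmetric cubic map: the tensor square of the identity is mixed with the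
identity along the diagonal, and half of the mixed components are tensored with the identity. -/
noncomputable def cubicPoly {n : ℕ} : CubicIndex n → MvPolynomial (Fin n) ℂ
  | .inl (j, k) => if j = k then .C (12 / 25) * (.X j ^ 2 - .X j) else .C (4 / 5) * .X j * .X k
  | .inr (j, k) => (.C (9 / 25) * .X j + .C (16 / 25) * .X j ^ 2) * .X k

theorem eval_cubicPoly_inl {n : ℕ} (z : Fin n → ℂ) (j k : Fin n) :
    MvPolynomial.eval z (cubicPoly (.inl (j, k))) =
      if j = k then 12 / 25 * (z j ^ 2 - z j) else 4 / 5 * z j * z k := by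
  rw [cubicPoly]
  split_ifs <;> simp

theorem eval_cubicPoly_inr {n : ℕ} (z : Fin n → ℂ) (j k : Fin n) :
    MvPolynomial.eval z (cubicPoly (.inr (j, k))) = mixPoly (z j) * z k := by
  simp [cubicPoly, mixPoly]

/-- The number of components of the symmetric cubic map. -/
abbrev cubicDim (n : ℕ) : ℕ := Fintype.card (CubicIndex n)

/-- The symmetric cubic map on all of `ℂⁿ`. -/
noncomputable def cubicMap {n : ℕ} (z : EuclideanSpace ℂ (Fin n)) :
    EuclideanSpace ℂ (Fin (cubicDim n)) :=
  WithLp.toLp 2 fun i =>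
    MvPolynomial.eval (fun j => z j) (cubicPoly ((Fintype.equivFin (CubicIndex n)).symm i))

/-- The Hermitian form `∑ c(zⱼ) conj c(wⱼ)` with `c = mixPoly`. -/
noncomputable def mixForm {n : ℕ} (w z : EuclideanSpace ℂ (Fin n)) : ℂ :=
  ∑ j, mixPoly (z j) * (starRingEnd ℂ) (mixPoly (w j))

theorem euclidean_inner_eq_sum {n : ℕ} (w z : EuclideanSpace ℂ (Fin n)) :
    inner ℂ w z = ∑ j, z j * (starRingEnd ℂ) (w j) := by
  rw [PiLp.inner_apply]
  rfl

/-- The defining function of the target ball pulls back to a multiple of that of the source. -/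
theorem one_sub_inner_cubicMap {n : ℕ} (w z : EuclideanSpace ℂ (Fin n)) :
    1 - inner ℂ (cubicMap w) (cubicMap z) =
      (1 - inner ℂ w z) * (1 + 16 / 25 * inner ℂ w z + mixForm w z) := by
  have h1 : inner ℂ (cubicMap w) (cubicMap z) =
      ∑ i : CubicIndex n, MvPolynomial.eval (fun j => z j) (cubicPoly i) *
        (starRingEnd ℂ) (MvPolynomial.eval (fun j => w j) (cubicPoly i)) := by
    rw [euclidean_inner_eq_sum]
    exact (Fintype.equivFin (CubicIndex n)).symm.sum_comp fun i =>
      MvPolynomial.eval (fun j => z j) (cubicPoly i) *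
        (starRingEnd ℂ) (MvPolynomial.eval (fun j => w j) (cubicPoly i))
  have h2 : ∑ i : Fin n × Fin n, MvPolynomial.eval (fun j => z j) (cubicPoly (.inr i)) *
        (starRingEnd ℂ) (MvPolynomial.eval (fun j => w j) (cubicPoly (.inr i))) =
      mixForm w z * inner ℂ w z := by
    rw [euclidean_inner_eq_sum, mixForm, Finset.sum_mul_sum, Fintype.sum_prod_type]
    refine Finset.sum_congr rfl fun j _ => Finset.sum_congr rfl fun k _ => ?_
    rw [eval_cubicPoly_inr, eval_cubicPoly_inr, map_mul]
    ring
  have h3 : ∑ i : Fin n × Fin n, MvPolynomial.eval (fun j => z j) (cubicPoly (.inl i)) *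
        (starRingEnd ℂ) (MvPolynomial.eval (fun j => w j) (cubicPoly (.inl i))) =
      16 / 25 * inner ℂ w z ^ 2 + 9 / 25 * inner ℂ w z - mixForm w z := by
    -- The diagonal term uses that a rotation preserves the Hermitian form of `(3/5 x, 4/5 x²)`: the
    -- component `12/25 (x² - x)` contributes whatever `c(x)` leaves over.
    have h4 : ∀ j k : Fin n, MvPolynomial.eval (fun j => z j) (cubicPoly (.inl (j, k))) *
        (starRingEnd ℂ) (MvPolynomial.eval (fun j => w j) (cubicPoly (.inl (j, k)))) =
        16 / 25 * ((z j * (starRingEnd ℂ) (w j)) * (z k * (starRingEnd ℂ) (w k))) +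
        if j = k then 9 / 25 * (z j * (starRingEnd ℂ) (w j)) -
          mixPoly (z j) * (starRingEnd ℂ) (mixPoly (w j)) else 0 := by
      intro j k
      rw [eval_cubicPoly_inl, eval_cubicPoly_inl]
      split_ifs with h
      · subst h
        simp only [mixPoly, map_mul, map_add, map_sub, map_pow, map_div₀, map_ofNat]
        ring
      · simp only [map_mul, map_div₀, map_ofNat]
        ring
    rw [Fintype.sum_prod_type]
    simp only [h4, Finset.sum_add_distrib, Finset.sum_ite_eq, Finset.mem_univ, if_true,
      Finset.sum_sub_distrib, ← Finset.mul_sum]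
    rw [← Finset.sum_mul, ← euclidean_inner_eq_sum, mixForm]
    ring
  rw [h1, Fintype.sum_sum_type, h2, h3]
  ring

theorem mixForm_self {n : ℕ} (z : EuclideanSpace ℂ (Fin n)) :
    mixForm z z = ((∑ j, ‖mixPoly (z j)‖ ^ 2 : ℝ) : ℂ) := by
  rw [mixForm]
  push_cast
  exact Finset.sum_congr rfl fun j _ => Complex.mul_conj' _

theorem one_sub_norm_sq_cubicMap {n : ℕ} (z : EuclideanSpace ℂ (Fin n)) :
    1 - ‖cubicMap z‖ ^ 2 =
      (1 - ‖z‖ ^ 2) * (1 + 16 / 25 * ‖z‖ ^ 2 + ∑ j, ‖mixPoly (z j)‖ ^ 2) := by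
  have h := one_sub_inner_cubicMap z z
  rw [inner_self_eq_ofReal_norm_sq, inner_self_eq_ofReal_norm_sq, mixForm_self] at h
  apply Complex.ofReal_injective
  push_cast at h ⊢
  exact h

theorem norm_cubicMap_lt_one_iff {n : ℕ} (z : EuclideanSpace ℂ (Fin n)) :
    ‖cubicMap z‖ < 1 ↔ ‖z‖ < 1 := by
  have h := one_sub_norm_sq_cubicMap z
  have h1 : 0 < 1 + 16 / 25 * ‖z‖ ^ 2 + ∑ j, ‖mixPoly (z j)‖ ^ 2 := by positivity
  have h2 : 0 < 1 - ‖cubicMap z‖ ^ 2 ↔ 0 < 1 - ‖z‖ ^ 2 := by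
    rw [h]
    exact ⟨fun h => pos_of_mul_pos_left h h1.le, fun h => mul_pos h h1⟩
  rw [sub_pos, sub_pos, sq_lt_one_iff₀ (norm_nonneg _), sq_lt_one_iff₀ (norm_nonneg _)] at h2
  exact h2

theorem continuous_cubicMap {n : ℕ} :
    Continuous (cubicMap : EuclideanSpace ℂ (Fin n) → _) := by
  refine (PiLp.continuous_toLp 2 _).comp (continuous_pi fun i => ?_)
  exact (MvPolynomial.continuous_eval _).comp (PiLp.continuous_ofLp 2 _)

/-- The symmetric cubic map between unit balls. -/
noncomputable def cubicBallMap (n : ℕ) (z : UnitBall n) : UnitBall (cubicDim n) :=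
  ⟨cubicMap z.1, mem_ball_zero_iff.2
    ((norm_cubicMap_lt_one_iff z.1).2 (mem_ball_zero_iff.1 z.2))⟩

theorem isProperMap_cubicBallMap (n : ℕ) : IsProperMap (cubicBallMap n) := by
  have : LocallyCompactSpace (UnitBall (cubicDim n)) :=
    Metric.isOpen_ball.isOpenEmbedding_subtypeVal.locallyCompactSpace
  rw [isProperMap_iff_isCompact_preimage]
  refine ⟨(continuous_cubicMap.comp continuous_subtype_val).subtype_mk _, fun K hK => ?_⟩
  rw [Subtype.isCompact_iff] at hK ⊢
  -- A point mapped into the open ball already lies in the open ball, so intersecting with the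
  -- compact closed ball adds no boundary points.
  have h : Subtype.val '' (cubicBallMap n ⁻¹' K) =
      Metric.closedBall 0 1 ∩ cubicMap ⁻¹' (Subtype.val '' K) := by
    ext z
    constructor
    · rintro ⟨z, hz, rfl⟩
      exact ⟨Metric.ball_subset_closedBall z.2, _, hz, rfl⟩
    · rintro ⟨-, y, hy, hyz⟩
      have hz : z ∈ Metric.ball (0 : EuclideanSpace ℂ (Fin n)) 1 := by
        rw [mem_ball_zero_iff, ← norm_cubicMap_lt_one_iff, ← hyz]
        exact mem_ball_zero_iff.1 y.2
      refine ⟨⟨z, hz⟩, ?_, rfl⟩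
      rwa [Set.mem_preimage, show cubicBallMap n ⟨z, hz⟩ = y from Subtype.ext hyz.symm]
  rw [h]
  exact (isCompact_closedBall _ _).inter_right (hK.isClosed.preimage continuous_cubicMap)

/-- The polynomial components of the symmetric cubic map. -/
noncomputable def cubicComponents (n : ℕ) (i : Fin (cubicDim n)) : MvPolynomial (Fin n) ℂ :=
  cubicPoly ((Fintype.equivFin (CubicIndex n)).symm i)

theorem isGivenBy_cubicBallMap (n : ℕ) : IsGivenBy (cubicBallMap n) (cubicComponents n) :=
  fun _ _ => rfl

theorem cubicPoly_inr_eq_monomial {n : ℕ} (j k : Fin n) : cubicPoly (.inr (j, k)) =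
    MvPolynomial.monomial (Finsupp.single j 1 + Finsupp.single k 1) (9 / 25 : ℂ) +
      MvPolynomial.monomial (Finsupp.single j 2 + Finsupp.single k 1) (16 / 25 : ℂ) := by
  simp only [cubicPoly, add_mul, MvPolynomial.C_mul_X_eq_monomial,
    MvPolynomial.C_mul_X_pow_eq_monomial]
  simp only [MvPolynomial.X, MvPolynomial.monomial_mul, mul_one]

theorem polyMapDegree_cubicComponents {n : ℕ} (hn : 1 ≤ n) :
    polyMapDegree (cubicComponents n) = 3 := by
  have hm : ∀ (j : Fin n) (s : ℕ), ((Finsupp.single j s).sum fun _ e => e) = s := fun j s =>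
    Finsupp.sum_single_index rfl
  apply le_antisymm
  · refine Finset.sup_le fun i _ => ?_
    rw [cubicComponents]
    rcases (Fintype.equivFin (CubicIndex n)).symm i with ⟨j, k⟩ | ⟨j, k⟩
    · rw [cubicPoly]
      split_ifs
      · refine (MvPolynomial.totalDegree_mul _ _).trans ?_
        have := MvPolynomial.totalDegree_sub (.X j ^ 2 : MvPolynomial (Fin n) ℂ) (.X j)
        rw [MvPolynomial.totalDegree_X_pow, MvPolynomial.totalDegree_X] at this
        rw [MvPolynomial.totalDegree_C]
        omega
      · refine (MvPolynomial.totalDegree_mul _ _).trans ?_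
        have := MvPolynomial.totalDegree_mul (.C (4 / 5) : MvPolynomial (Fin n) ℂ) (.X j)
        rw [MvPolynomial.totalDegree_C, MvPolynomial.totalDegree_X] at this
        rw [MvPolynomial.totalDegree_X]
        omega
    · rw [cubicPoly]
      refine (MvPolynomial.totalDegree_mul _ _).trans ?_
      have h := MvPolynomial.totalDegree_add (.C (9 / 25) * .X j : MvPolynomial (Fin n) ℂ)
        (.C (16 / 25) * .X j ^ 2)
      have h1 := MvPolynomial.totalDegree_mul (.C (9 / 25) : MvPolynomial (Fin n) ℂ) (.X j)
      have h2 := MvPolynomial.totalDegree_mul (.C (16 / 25) : MvPolynomial (Fin n) ℂ) (.X j ^ 2)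
      rw [MvPolynomial.totalDegree_C, MvPolynomial.totalDegree_X] at h1
      rw [MvPolynomial.totalDegree_C, MvPolynomial.totalDegree_X_pow] at h2
      rw [MvPolynomial.totalDegree_X]
      omega
  -- The component `c(z_j) z_j` contains `z_j³` with coefficient 16/25.
  · set j : Fin n := ⟨0, hn⟩
    have h : 3 ≤ (cubicPoly (.inr (j, j))).totalDegree := by
      have h1 : Finsupp.single j 3 ∈ (cubicPoly (.inr (j, j))).support := by
        rw [MvPolynomial.mem_support_iff, cubicPoly_inr_eq_monomial, MvPolynomial.coeff_add,
          MvPolynomial.coeff_monomial, MvPolynomial.coeff_monomial, ← Finsupp.single_add,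
          ← Finsupp.single_add, if_neg, if_pos rfl]
        · norm_num
        · intro h
          have := DFunLike.congr_fun h j
          simp at this
      simpa [hm] using MvPolynomial.le_totalDegree h1
    refine h.trans ?_
    have h2 := Finset.le_sup (f := fun i => (cubicComponents n i).totalDegree)
      (Finset.mem_univ (Fintype.equivFin (CubicIndex n) (.inr (j, j))))
    simpa only [cubicComponents, Equiv.symm_apply_apply, polyMapDegree] using h2

/-! ### Permutations belong to the invariant group -/

/-- Coordinate permutations of the source lift to coordinate permutations of the target. -/
theorem symmetricSubgroup_le_hermitianInvariantGroup (n : ℕ) :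
    symmetricSubgroup n ≤ hermitianInvariantGroup (cubicBallMap n) := by
  rintro _ ⟨σ, rfl⟩
  set e := Fintype.equivFin (CubicIndex n)
  set τ : Equiv.Perm (CubicIndex n) :=
    Equiv.sumCongr (Equiv.prodCongr σ σ) (Equiv.prodCongr σ σ)
  set π : Equiv.Perm (Fin (cubicDim n)) := e.symm.trans (τ.trans e)
  refine ⟨⟨coordPerm π, coordPerm_mem_ballAut π⟩, fun z => ?_⟩
  ext i
  change _ = (cubicBallMap n z).1 (π.symm i)
  obtain ⟨i, rfl⟩ := e.surjective i
  have hi : π.symm (e i) = e (τ.symm i) := by simp [π]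
  rw [hi]
  simp only [cubicBallMap, cubicMap, e, Equiv.symm_apply_apply]
  have hσ : ∀ j, (((coordPermHom n) σ).1 z).1 j = z.1 (σ.symm j) := fun j => rfl
  simp only [hσ]
  rcases i with ⟨j, k⟩ | ⟨j, k⟩
  · have hτ : τ.symm (.inl (j, k)) = .inl (σ.symm j, σ.symm k) := rfl
    rw [hτ, eval_cubicPoly_inl, eval_cubicPoly_inl]
    simp
  · have hτ : τ.symm (.inr (j, k)) = .inr (σ.symm j, σ.symm k) := rfl
    rw [hτ, eval_cubicPoly_inr, eval_cubicPoly_inr]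

/-! ### Root location for the restriction to a line -/

open Polynomial in
/-- If `1 + uλ + vλ²` has no root besides `1 / r`, then `u` has nonpositive real part. -/
theorem re_nonpos_of_roots {r : ℝ} (hr : 0 < r) {u v : ℂ}
    (h : ∀ t : ℂ, 1 + u * t + v * t ^ 2 = 0 → 1 = r * t) : u.re ≤ 0 := by
  have hr' : (r : ℂ) ≠ 0 := by exact_mod_cast hr.ne'
  rcases eq_or_ne v 0 with rfl | hv
  · rcases eq_or_ne u 0 with rfl | hu
    · simp
    have h1 := h (-u⁻¹) (by field_simp; simp)
    have h2 : u = -r := by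
      field_simp at h1
      exact h1
    rw [h2]
    simpa using hr.le
  · obtain ⟨t, ht⟩ := IsAlgClosed.exists_root (C v * X ^ 2 + C u * X + C 1 : ℂ[X])
      (by rw [degree_quadratic hv]; decide)
    have ht' : 1 + u * t + v * t ^ 2 = 0 := by
      simp only [IsRoot.def, eval_add, eval_mul, eval_C, eval_pow, eval_X] at ht
      rw [← ht]
      ring
    have h1 := h t ht'
    have ht0 : t ≠ 0 := by
      rintro rfl
      simp at h1
    have hrt : (r : ℂ) = 1 / t := by rw [eq_div_iff ht0, ← h1]
    -- The roots have product `1 / v` and one of them is `1 / r`, so the other is `r / v`; it must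
    -- equal `1 / r` as well, and the quadratic is `(1 - r t)²`.
    have h2 := h (r / v) (by
      rw [hrt]
      field_simp
      linear_combination ht')
    have h3 : v = r ^ 2 := by
      field_simp at h2
      exact h2
    have h4 : u = -2 * r := by
      rw [h3] at ht'
      have : u * t = -2 := by linear_combination ht' + (-(r * t) - 1) * (-h1)
      rw [hrt]
      field_simp
      exact this
    rw [h4]
    simpa using hr.le

open Polynomial in
-- The identity is polynomial, so it extends from the disc to all `ζ`. If `t` were a root of `1 + ut
-- + vt²` with `r t ≠ 1`, then `ζ = (1 - t)/(1 - r t)`, for which `(1 - ζ)/(1 - r ζ) = t`, would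
-- make the left side vanish but not the right. Hence only `1 / r` can be a root.
theorem re_nonpos_of_factor_identity {r : ℝ} (hr : 0 < r) (hr1 : r < 1) {u v A B : ℂ}
    (hB : B ≠ 0) (h : ℂ[X])
    (hid : ∀ ζ : ℂ, ‖ζ‖ < 1 →
      A * ((1 - r * ζ) ^ 2 + u * (1 - ζ) * (1 - r * ζ) + v * (1 - ζ) ^ 2) * h.eval ζ =
        B * (1 - r * ζ) ^ 3) : u.re ≤ 0 := by
  have hall : ∀ ζ : ℂ,
      A * ((1 - r * ζ) ^ 2 + u * (1 - ζ) * (1 - r * ζ) + v * (1 - ζ) ^ 2) * h.eval ζ =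
        B * (1 - r * ζ) ^ 3 := by
    have hpoly : C A * ((1 - C (r : ℂ) * X) ^ 2 + C u * (1 - X) * (1 - C (r : ℂ) * X) +
        C v * (1 - X) ^ 2) * h = C B * (1 - C (r : ℂ) * X) ^ 3 := by
      refine eq_of_infinite_eval_eq _ _ (Set.Infinite.mono (s := Metric.ball (0 : ℂ) 1) ?_ ?_)
      · intro ζ hζ
        simpa using hid ζ (mem_ball_zero_iff.1 hζ)
      · exact infinite_of_mem_nhds 0 (Metric.ball_mem_nhds _ one_pos)
    intro ζ
    simpa using congrArg (eval ζ) hpoly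
  refine re_nonpos_of_roots hr (v := v) fun t ht => ?_
  by_contra hne
  have h1 : 1 - r * t ≠ 0 := sub_ne_zero.2 hne
  have h2 : (1 - r : ℂ) ≠ 0 := by
    have : 1 - r ≠ 0 := by linarith
    exact_mod_cast this
  have h3 : 1 - r * ((1 - t) / (1 - r * t)) = (1 - r) / (1 - r * t) := by
    field_simp
    ring
  have h4 : 1 - (1 - t) / (1 - r * t) = t * ((1 - r) / (1 - r * t)) := by
    rw [← mul_div_assoc, eq_div_iff h1, sub_mul, div_mul_cancel₀ _ h1]
    ring
  have h5 := hall ((1 - t) / (1 - r * t))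
  rw [h3, h4] at h5
  have h6 : ((1 - r) / (1 - r * t)) ^ 2 + u * (t * ((1 - r) / (1 - r * t))) *
      ((1 - r) / (1 - r * t)) + v * (t * ((1 - r) / (1 - r * t))) ^ 2 = 0 := by
    linear_combination ((1 - r) / (1 - r * t)) ^ 2 * ht
  rw [h6, mul_zero, zero_mul] at h5
  exact mul_ne_zero hB (pow_ne_zero 3 (div_ne_zero h2 h1)) h5.symm

/-- The restriction of a coordinate functional of the cubic map to a complex line is polynomial. -/
theorem exists_polynomial_one_sub_inner_cubicMap {n : ℕ} (a : EuclideanSpace ℂ (Fin (cubicDim n)))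
    (b : EuclideanSpace ℂ (Fin n)) :
    ∃ h : Polynomial ℂ, ∀ ζ : ℂ, h.eval ζ = 1 - inner ℂ a (cubicMap (ζ • b)) := by
  refine ⟨1 - ∑ i, MvPolynomial.aeval (fun j => Polynomial.X * Polynomial.C (b j))
    (cubicComponents n i) * Polynomial.C ((starRingEnd ℂ) (a i)), fun ζ => ?_⟩
  rw [euclidean_inner_eq_sum, Polynomial.eval_sub, Polynomial.eval_one, Polynomial.eval_finsetSum]
  congr 1
  refine Finset.sum_congr rfl fun i _ => ?_
  rw [Polynomial.eval_mul, Polynomial.eval_C]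
  congr 1
  rw [← Polynomial.coe_aeval_eq_eval]
  refine (MvPolynomial.comp_aeval_apply _ (Polynomial.aeval ζ) _).trans ?_
  simp only [map_mul, Polynomial.aeval_X, Polynomial.aeval_C, Algebra.algebraMap_self_apply]
  rw [MvPolynomial.aeval_eq_eval]
  rfl

/-! ### The quotient form and its linear coefficient -/

/-- The quotient of the defining functions of the target and source balls. -/
noncomputable def cubicQuotient {n : ℕ} (w z : EuclideanSpace ℂ (Fin n)) : ℂ :=
  1 + 16 / 25 * inner ℂ w z + mixForm w z

theorem mixForm_zero_left {n : ℕ} (z : EuclideanSpace ℂ (Fin n)) : mixForm 0 z = 0 := by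
  simp [mixForm, mixPoly]

theorem cubicQuotient_zero_left {n : ℕ} (z : EuclideanSpace ℂ (Fin n)) :
    cubicQuotient 0 z = 1 := by
  simp [cubicQuotient, mixForm_zero_left]

theorem cubicMap_zero {n : ℕ} : cubicMap (0 : EuclideanSpace ℂ (Fin n)) = 0 := by
  have h := one_sub_norm_sq_cubicMap (0 : EuclideanSpace ℂ (Fin n))
  simpa [mixPoly] using h

theorem cubicQuotient_smul {n : ℕ} (c : EuclideanSpace ℂ (Fin n)) (t : ℂ) :
    cubicQuotient c (t • c) =
      1 + (16 / 25 * (‖c‖ : ℂ) ^ 2 + 9 / 25 * ∑ j, c j * (starRingEnd ℂ) (mixPoly (c j))) * t +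
        (16 / 25 * ∑ j, c j ^ 2 * (starRingEnd ℂ) (mixPoly (c j))) * t ^ 2 := by
  have h : mixForm c (t • c) = 9 / 25 * t * ∑ j, c j * (starRingEnd ℂ) (mixPoly (c j)) +
      16 / 25 * t ^ 2 * ∑ j, c j ^ 2 * (starRingEnd ℂ) (mixPoly (c j)) := by
    rw [mixForm, Finset.mul_sum, Finset.mul_sum, ← Finset.sum_add_distrib]
    refine Finset.sum_congr rfl fun j _ => ?_
    rw [PiLp.smul_apply, smul_eq_mul]
    nth_rewrite 1 [mixPoly]
    ring
  rw [cubicQuotient, h, inner_smul_right, inner_self_eq_ofReal_norm_sq]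
  ring

/-- The weights of `mixPoly` are positive with sum 1, so `‖mixPoly x‖ ≤ ‖x‖` on the closed disc. -/
theorem neg_norm_sq_le_re_mul_mixPoly {x : ℂ} (hx : ‖x‖ ≤ 1) :
    -‖x‖ ^ 2 ≤ (x * (starRingEnd ℂ) (mixPoly x)).re := by
  have h1 : ‖mixPoly x‖ ≤ ‖x‖ := by
    refine (norm_add_le _ _).trans ?_
    rw [norm_mul, norm_mul, norm_pow, norm_div, norm_div]
    simp only [Complex.norm_ofNat]
    nlinarith [norm_nonneg x]
  have h2 := Complex.abs_re_le_norm (x * (starRingEnd ℂ) (mixPoly x))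
  rw [norm_mul, RCLike.norm_conj] at h2
  nlinarith [neg_abs_le (x * (starRingEnd ℂ) (mixPoly x)).re, norm_nonneg x]

/-- The second term is at worst `-9/25 ‖c‖²`, leaving at least `7/25 ‖c‖²`. -/
theorem re_linear_coeff_pos {n : ℕ} {c : EuclideanSpace ℂ (Fin n)} (hc : ‖c‖ < 1) (h0 : c ≠ 0) :
    0 < (16 / 25 * (‖c‖ : ℂ) ^ 2 +
      9 / 25 * ∑ j, c j * (starRingEnd ℂ) (mixPoly (c j))).re := by
  have h1 : -‖c‖ ^ 2 ≤ (∑ j, c j * (starRingEnd ℂ) (mixPoly (c j))).re := by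
    rw [EuclideanSpace.norm_sq_eq, ← Finset.sum_neg_distrib, Complex.re_sum]
    exact Finset.sum_le_sum fun j _ =>
      neg_norm_sq_le_re_mul_mixPoly ((PiLp.norm_apply_le c j).trans hc.le)
  have h2 : (16 / 25 * (‖c‖ : ℂ) ^ 2 +
      9 / 25 * ∑ j, c j * (starRingEnd ℂ) (mixPoly (c j))).re =
      16 / 25 * ‖c‖ ^ 2 + 9 / 25 * (∑ j, c j * (starRingEnd ℂ) (mixPoly (c j))).re := by
    rw [show (16 / 25 : ℂ) * (‖c‖ : ℂ) ^ 2 = ((16 / 25 * ‖c‖ ^ 2 : ℝ) : ℂ) by push_cast; ring,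
      show (9 / 25 : ℂ) = ((9 / 25 : ℝ) : ℂ) by push_cast; ring, Complex.add_re,
      Complex.ofReal_re, Complex.re_ofReal_mul]
  rw [h2]
  have h3 : 0 < ‖c‖ ^ 2 := by
    have := norm_pos_iff.2 h0
    positivity
  linarith

/-! ### Invariant automorphisms are linear -/

section Invariance

variable {n : ℕ} {γ : ballAut n} {ψ : ballAut (cubicDim n)}
  {L : EuclideanSpace ℂ (Fin n) →ₗᵢ[ℂ] EuclideanSpace ℂ (Fin n)}
  {b : EuclideanSpace ℂ (Fin n)}
  {M : EuclideanSpace ℂ (Fin (cubicDim n)) →ₗᵢ[ℂ] EuclideanSpace ℂ (Fin (cubicDim n))}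
  {a : EuclideanSpace ℂ (Fin (cubicDim n))}

/-- This is the transformation law of `1 - ⟪·, ·⟫` under `ψ` divided by the law under `γ`; the
common factor `1 - ⟪w, z⟫` does not vanish on the ball. -/
theorem cubicQuotient_ballAut
    (hf : ∀ z, cubicBallMap n (γ.1 z) = ψ.1 (cubicBallMap n z))
    (hb : ‖b‖ < 1) (hγ : ∀ z : UnitBall n, (γ.1 z).1 = L (mobius b z))
    (ha : ‖a‖ < 1) (hψ : ∀ z : UnitBall (cubicDim n), (ψ.1 z).1 = M (mobius a z))
    (w z : UnitBall n) :
    ballScale b ^ 2 * cubicQuotient (γ.1 w).1 (γ.1 z).1 *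
        ((1 - inner ℂ (cubicMap w.1) a) * (1 - inner ℂ a (cubicMap z.1))) =
      ballScale a ^ 2 * cubicQuotient w.1 z.1 *
        ((1 - inner ℂ w.1 b) * (1 - inner ℂ b z.1)) := by
  have h1 := one_sub_inner_ballAut hb hγ w z
  have h2 := one_sub_inner_ballAut ha hψ (cubicBallMap n w) (cubicBallMap n z)
  rw [← hf, ← hf] at h2
  simp only [cubicBallMap, one_sub_inner_cubicMap] at h2
  have h3 : 1 - inner ℂ w.1 z.1 ≠ 0 :=
    one_sub_inner_ne_zero (mem_ball_zero_iff.1 w.2) (mem_ball_zero_iff.1 z.2)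
  rw [cubicQuotient, cubicQuotient]
  refine mul_left_cancel₀ h3 ?_
  linear_combination ((1 - inner ℂ w.1 b) * (1 - inner ℂ b z.1)) * h2 -
    (1 + 16 / 25 * inner ℂ (γ.1 w).1 (γ.1 z).1 + mixForm (γ.1 w).1 (γ.1 z).1) *
      ((1 - inner ℂ (cubicMap w.1) a) * (1 - inner ℂ a (cubicMap z.1))) * h1

/-- Polarizing at `w = 0` removes the conjugate factors, because `cubicMap` fixes the origin, and
leaves an identity holomorphic in `z`. Here `L b` is `γ(0)`. -/
theorem cubicQuotient_ballAut_zero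
    (hf : ∀ z, cubicBallMap n (γ.1 z) = ψ.1 (cubicBallMap n z))
    (hb : ‖b‖ < 1) (hγ : ∀ z : UnitBall n, (γ.1 z).1 = L (mobius b z))
    (ha : ‖a‖ < 1) (hψ : ∀ z : UnitBall (cubicDim n), (ψ.1 z).1 = M (mobius a z))
    (z : UnitBall n) :
    ballScale b ^ 2 * cubicQuotient (L b) (γ.1 z).1 * (1 - inner ℂ a (cubicMap z.1)) =
      ballScale a ^ 2 * (1 - inner ℂ b z.1) := by
  have h := cubicQuotient_ballAut hf hb hγ ha hψ ⟨0, by simp⟩ z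
  rw [hγ ⟨0, by simp⟩] at h
  simpa [mobius_zero, cubicMap_zero, cubicQuotient_zero_left] using h

/-- Along `z = ζ b` the holomorphic identity, cleared of denominators, is the hypothesis of
`re_nonpos_of_factor_identity` with `r = ‖b‖²`; its conclusion contradicts `re_linear_coeff_pos` at
`c = L b`. -/
theorem eq_zero_of_intertwines
    (hf : ∀ z, cubicBallMap n (γ.1 z) = ψ.1 (cubicBallMap n z))
    (hb : ‖b‖ < 1) (hγ : ∀ z : UnitBall n, (γ.1 z).1 = L (mobius b z))
    (ha : ‖a‖ < 1) (hψ : ∀ z : UnitBall (cubicDim n), (ψ.1 z).1 = M (mobius a z)) :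
    b = 0 := by
  by_contra hb0
  have hc0 : L b ≠ 0 := (map_ne_zero_iff L L.injective).2 hb0
  have hc : ‖L b‖ < 1 := by rwa [L.norm_map]
  have hpos := norm_pos_iff.2 hb0
  obtain ⟨h, hh⟩ := exists_polynomial_one_sub_inner_cubicMap a b
  refine (re_linear_coeff_pos hc hc0).not_ge ?_
  refine re_nonpos_of_factor_identity (r := ‖b‖ ^ 2) (by positivity) (by nlinarith)
    (v := 16 / 25 * ∑ j, L b j ^ 2 * (starRingEnd ℂ) (mixPoly (L b j)))
    (A := ballScale b ^ 2) (ballScale_sq_ne_zero ha) h fun ζ hζ => ?_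
  have hz : ‖ζ • b‖ < 1 := by
    rw [norm_smul]
    nlinarith [norm_nonneg ζ]
  have h1 := cubicQuotient_ballAut_zero hf hb hγ ha hψ ⟨ζ • b, mem_ball_zero_iff.2 hz⟩
  have h2 := one_sub_inner_ne_zero hb hz
  rw [inner_smul_right, inner_self_eq_ofReal_norm_sq, mul_comm] at h2
  rw [hγ, mobius_smul_self hb, map_smul, cubicQuotient_smul, inner_smul_right,
    inner_self_eq_ofReal_norm_sq, ← hh, mul_comm ζ] at h1
  set u := 16 / 25 * (‖L b‖ : ℂ) ^ 2 +
    9 / 25 * ∑ j, L b j * (starRingEnd ℂ) (mixPoly (L b j))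
  set v := 16 / 25 * ∑ j, L b j ^ 2 * (starRingEnd ℂ) (mixPoly (L b j))
  push_cast
  have h3 : (1 - (‖b‖ : ℂ) ^ 2 * ζ) ^ 2 + u * (1 - ζ) * (1 - (‖b‖ : ℂ) ^ 2 * ζ) +
      v * (1 - ζ) ^ 2 = (1 + u * ((1 - ζ) / (1 - (‖b‖ : ℂ) ^ 2 * ζ)) +
        v * ((1 - ζ) / (1 - (‖b‖ : ℂ) ^ 2 * ζ)) ^ 2) * (1 - (‖b‖ : ℂ) ^ 2 * ζ) ^ 2 := by
    field_simp
  rw [h3]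
  linear_combination (1 - (‖b‖ : ℂ) ^ 2 * ζ) ^ 2 * h1

/-- An automorphism in the invariant group is linear and preserves the mixed form. -/
theorem exists_linearIsometry_of_intertwines
    (hf : ∀ z, cubicBallMap n (γ.1 z) = ψ.1 (cubicBallMap n z)) :
    ∃ U : EuclideanSpace ℂ (Fin n) →ₗᵢ[ℂ] EuclideanSpace ℂ (Fin n),
      (∀ z : UnitBall n, (γ.1 z).1 = U z) ∧
      ∀ w z : UnitBall n, mixForm (U w) (U z) = mixForm w.1 z.1 := by
  obtain ⟨L, b, hb, hγ⟩ := exists_eq_linearIsometry_mobius γ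
  obtain ⟨M, a, ha, hψ⟩ := exists_eq_linearIsometry_mobius ψ
  obtain rfl := eq_zero_of_intertwines hf hb hγ ha hψ
  have hs : ballScale (0 : EuclideanSpace ℂ (Fin n)) = 1 := by simp [ballScale]
  -- For `b = 0` the `w = 0` identity makes `1 - ⟪a, f z⟫` constant, and its value at the origin is
  -- 1. All multipliers are then trivial.
  have h0 : ∀ z : UnitBall n,
      1 - inner ℂ a (cubicMap z.1) = ballScale a ^ 2 := fun z => by
    simpa [hs, cubicQuotient_zero_left] using cubicQuotient_ballAut_zero hf hb hγ ha hψ z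
  have hsa : ballScale a ^ 2 = 1 := by
    simpa [cubicMap_zero] using (h0 ⟨0, by simp⟩).symm
  have h0' : ∀ w : UnitBall n, 1 - inner ℂ (cubicMap w.1) a = 1 := fun w => by
    have := congrArg (starRingEnd ℂ) ((h0 w).trans hsa)
    simpa only [map_sub, map_one, inner_conj_symm] using this
  -- The involution at the origin is `z ↦ -z`.
  have hγ' : ∀ z : UnitBall n, (γ.1 z).1 =
      L.comp (LinearIsometryEquiv.neg ℂ).toLinearIsometry z.1 := fun z => by
    rw [hγ]
    simp [mobius, mobiusLin, hs]
  refine ⟨L.comp (LinearIsometryEquiv.neg ℂ).toLinearIsometry, hγ', fun w z => ?_⟩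
  have h1 := cubicQuotient_ballAut hf hb hγ ha hψ w z
  rw [h0, h0', hsa, hs, hγ', hγ', cubicQuotient, cubicQuotient,
    LinearIsometry.inner_map_map] at h1
  simpa using h1

end Invariance

/-! ### Isometries preserving the mixed form are permutations -/

/-- The coordinatewise square of a vector. -/
noncomputable def coordSq {n : ℕ} (z : EuclideanSpace ℂ (Fin n)) : EuclideanSpace ℂ (Fin n) :=
  WithLp.toLp 2 fun j => z j ^ 2

/-- The signs extract the part odd in `w` and even in `z`, namely linear times squared terms;
`576/625 = 4 · 9/25 · 16/25`. -/
theorem mixForm_parity {n : ℕ} (w z : EuclideanSpace ℂ (Fin n)) :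
    mixForm w z + mixForm w (-z) - mixForm (-w) z - mixForm (-w) (-z) =
      576 / 625 * inner ℂ w (coordSq z) := by
  simp only [mixForm, euclidean_inner_eq_sum, Finset.mul_sum, ← Finset.sum_add_distrib,
    ← Finset.sum_sub_distrib]
  refine Finset.sum_congr rfl fun j _ => ?_
  simp only [mixPoly, coordSq, PiLp.neg_apply, map_add, map_mul, map_div₀, map_ofNat, map_pow,
    map_neg]
  ring

/-- A linear isometry preserving the mixed form on the ball is multiplicative. -/
theorem coordSq_map_of_mixForm_invariant {n : ℕ}
    {U : EuclideanSpace ℂ (Fin n) →ₗᵢ[ℂ] EuclideanSpace ℂ (Fin n)}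
    (hU : ∀ w z : UnitBall n, mixForm (U w) (U z) = mixForm w.1 z.1)
    (z : EuclideanSpace ℂ (Fin n)) : coordSq (U z) = U (coordSq z) := by
  have hball : ∀ w z : EuclideanSpace ℂ (Fin n), ‖w‖ < 1 → ‖z‖ < 1 →
      inner ℂ (U w) (coordSq (U z)) = inner ℂ w (coordSq z) := by
    intro w z hw hz
    have hU' : ∀ w z : EuclideanSpace ℂ (Fin n), ‖w‖ < 1 → ‖z‖ < 1 →
        mixForm (U w) (U z) = mixForm w z := fun w z hw hz =>
      hU ⟨w, mem_ball_zero_iff.2 hw⟩ ⟨z, mem_ball_zero_iff.2 hz⟩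
    have hw' : ‖-w‖ < 1 := by rwa [norm_neg]
    have hz' : ‖-z‖ < 1 := by rwa [norm_neg]
    have h := mixForm_parity (U w) (U z)
    rw [← map_neg, ← map_neg, hU' _ _ hw hz, hU' _ _ hw hz', hU' _ _ hw' hz, hU' _ _ hw' hz',
      mixForm_parity] at h
    exact (mul_left_cancel₀ (by norm_num) h).symm
  have hsmul : ∀ (t : ℂ) (z : EuclideanSpace ℂ (Fin n)), coordSq (t • z) = t ^ 2 • coordSq z := by
    intro t z
    ext j
    simp [coordSq, mul_pow]
  -- Both sides are conjugate-linear in `w` and homogeneous of degree 2 in `z`, so scaling by a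
  -- small real `t` removes the restriction to the ball.
  have hall : ∀ w z : EuclideanSpace ℂ (Fin n),
      inner ℂ (U w) (coordSq (U z)) = inner ℂ w (coordSq z) := by
    intro w z
    set t : ℝ := (1 + ‖w‖ + ‖z‖)⁻¹
    have hpos : 0 < 1 + ‖w‖ + ‖z‖ := by positivity
    have ht0 : (t : ℂ) ≠ 0 := by exact_mod_cast (inv_pos.2 hpos).ne'
    have hlt : ∀ x : EuclideanSpace ℂ (Fin n), ‖x‖ < 1 + ‖w‖ + ‖z‖ → ‖(t : ℂ) • x‖ < 1 := by
      intro x hx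
      rw [norm_smul, Complex.norm_real, Real.norm_of_nonneg (inv_pos.2 hpos).le,
        inv_mul_lt_iff₀ hpos, mul_one]
      exact hx
    have h := hball _ _ (hlt w (by linarith [norm_nonneg z])) (hlt z (by linarith [norm_nonneg w]))
    rw [map_smul, map_smul, hsmul, hsmul, inner_smul_left, inner_smul_right, inner_smul_left,
      inner_smul_right] at h
    exact mul_left_cancel₀ (pow_ne_zero 2 ht0)
      (mul_left_cancel₀ ((map_ne_zero (starRingEnd ℂ)).2 ht0) h)
  -- In finite dimension `U` is onto, so `w` can be chosen to make the difference orthogonal to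
  -- itself.
  obtain ⟨w, hw⟩ := (LinearMap.injective_iff_surjective (f := U.toLinearMap)).1 U.injective
    (coordSq (U z) - U (coordSq z))
  have hw' : U w = coordSq (U z) - U (coordSq z) := hw
  have h := hall w z
  rw [← U.inner_map_map w (coordSq z), ← sub_eq_zero, ← inner_sub_right, hw', inner_self_eq_zero,
    sub_eq_zero] at h
  exact h

/-- An idempotent unit vector of `ℂⁿ` is a standard basis vector. -/
theorem exists_eq_single_of_coordSq_eq {n : ℕ} {x : EuclideanSpace ℂ (Fin n)}
    (hx : coordSq x = x) (h1 : ‖x‖ = 1) : ∃ j, x = EuclideanSpace.single j 1 := by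
  have h01 : ∀ j, x j = 0 ∨ x j = 1 := by
    intro j
    have h : x j ^ 2 = x j := congrArg (fun y : EuclideanSpace ℂ (Fin n) => y j) hx
    have : x j * (x j - 1) = 0 := by linear_combination h
    simpa [sub_eq_zero] using this
  have hx0 : x ≠ 0 := by
    rintro rfl
    simp at h1
  obtain ⟨j, hj⟩ : ∃ j, x j ≠ 0 := by
    by_contra! h
    exact hx0 (by ext j; simpa using h j)
  refine ⟨j, ?_⟩
  have hsum : ∑ k, ‖x k‖ ^ 2 = 1 := by rw [← EuclideanSpace.norm_sq_eq, h1, one_pow]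
  have hj1 : x j = 1 := (h01 j).resolve_left hj
  rw [← Finset.add_sum_erase _ _ (Finset.mem_univ j), hj1, norm_one, one_pow, add_eq_left,
    Finset.sum_eq_zero_iff_of_nonneg fun _ _ => by positivity] at hsum
  ext k
  rcases eq_or_ne k j with rfl | hk
  · simpa using hj1
  · have := hsum k (Finset.mem_erase.2 ⟨hk, Finset.mem_univ k⟩)
    simpa [hk] using this

theorem exists_perm_of_mixForm_invariant {n : ℕ}
    {U : EuclideanSpace ℂ (Fin n) →ₗᵢ[ℂ] EuclideanSpace ℂ (Fin n)}
    (hU : ∀ w z : UnitBall n, mixForm (U w) (U z) = mixForm w.1 z.1) :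
    ∃ σ : Equiv.Perm (Fin n), ∀ z i, U z i = z (σ.symm i) := by
  have h : ∀ i, ∃ j, U (EuclideanSpace.single i 1) = EuclideanSpace.single j 1 := by
    intro i
    apply exists_eq_single_of_coordSq_eq
    · rw [coordSq_map_of_mixForm_invariant hU]
      congr 1
      ext j
      by_cases hj : j = i <;> simp [coordSq, hj]
    · rw [U.norm_map]
      simp
  choose σ hσ using h
  have hinj : Function.Injective σ := by
    intro i j hij
    have h1 : U (EuclideanSpace.single i 1) = U (EuclideanSpace.single j 1) := by
      rw [hσ, hσ, hij]
    have h2 := congrArg (fun y : EuclideanSpace ℂ (Fin n) => y i) (U.injective h1)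
    by_contra hne
    simp [hne] at h2
  refine ⟨Equiv.ofBijective σ (Finite.injective_iff_bijective.1 hinj), fun z i => ?_⟩
  obtain ⟨i, rfl⟩ := (Equiv.ofBijective σ (Finite.injective_iff_bijective.1 hinj)).surjective i
  rw [Equiv.symm_apply_apply]
  -- Pairing `U z` with `U e_i = e_{σ i}` reads off the coordinate `σ i`.
  have h3 := U.inner_map_map (EuclideanSpace.single i 1) z
  rw [hσ, EuclideanSpace.inner_single_left, EuclideanSpace.inner_single_left] at h3
  simpa using h3

theorem hermitianInvariantGroup_cubicBallMap (n : ℕ) :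
    hermitianInvariantGroup (cubicBallMap n) = symmetricSubgroup n := by
  refine le_antisymm ?_ (symmetricSubgroup_le_hermitianInvariantGroup n)
  rintro γ ⟨ψ, hψ⟩
  obtain ⟨U, hγ, hU⟩ := exists_linearIsometry_of_intertwines hψ
  obtain ⟨σ, hσ⟩ := exists_perm_of_mixForm_invariant hU
  refine ⟨σ, Subtype.ext (Equiv.ext fun z => Subtype.ext ?_)⟩
  ext i
  rw [hγ, hσ]
  rfl

theorem proposition6p1 (n : ℕ) :
    (∃ (N : ℕ) (f : UnitBall n → UnitBall N) (p : Fin N → MvPolynomial (Fin n) ℂ),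
      IsGivenBy f p ∧ IsProperMap f ∧
        hermitianInvariantGroup f = symmetricSubgroup n) ∧
    (2 ≤ n →
      ∃ (N : ℕ) (f : UnitBall n → UnitBall N) (p : Fin N → MvPolynomial (Fin n) ℂ),
        IsGivenBy f p ∧ polyMapDegree p = 3 ∧ IsProperMap f ∧
          hermitianInvariantGroup f = symmetricSubgroup n) :=
  ⟨⟨cubicDim n, cubicBallMap n, cubicComponents n, isGivenBy_cubicBallMap n,
    isProperMap_cubicBallMap n, hermitianInvariantGroup_cubicBallMap n⟩,
  fun hn => ⟨cubicDim n, cubicBallMap n, cubicComponents n, isGivenBy_cubicBallMap n,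
    polyMapDegree_cubicComponents (one_le_two.trans hn), isProperMap_cubicBallMap n,
    hermitianInvariantGroup_cubicBallMap n⟩⟩
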